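/- Let $(S_n)_{n\ge 0}$ be the symmetric random walk on the three-dimensional diagonal lattice: $S_0=(0,0,0)$, and the increments $S_{n+1}-S_n$ are independent, each uniformly distributed on the eight vectors $(\pm1,\pm1,\pm1)$. For $x=(u,v,w)\in\mathbb Z^3$ let $F(x)$ be the expected number of visits to $x$ (equivalently, of departures from $x$), that is, the expected number of $n\ge 0$ with $S_n=x$. The walk is transient: almost surely each point is visited only finitely often; moreover $F(x)<\infty$ for every $x\in\mathbb Z^3$. For all integers $u,v,w$, $$F(u,v,w)=\frac1{\pi^2}\int_0^\pi\!\int_0^\pi \frac{\cos(u\lambda)\,\cos(v\mu)\,e^{-|w|\theta}}{\tanh\theta}\,d\lambda\,d\mu ,$$ where the integral converges absolutely and $\theta=\theta(\lambda,\mu)$ is, for $\cos\lambda\cos\mu\ne0$, any complex number with $\operatorname{Re}\theta\ge 0$ and $\cos\lambda\,\cos\mu\,\cosh\theta=1$ (such numbers exist, and off a null set of $(\lambda,\mu)$ the integrand does not depend on the choice). Moreover, $F$ is the unique function $H:\mathbb Z^3\to\mathbb R$ with $H(x)\to0$ as $|x|\to\infty$ that solves $$H(x)=\delta_{x,0}+\frac18\sum_{e\in\{-1,1\}^3}H(x+e)\qquad(x\in\mathbb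 Z^3).$$ -/

import Mathlib

open MeasureTheory ProbabilityTheory Filter Topology
open scoped ENNReal

namespace DiagonalLattice

/-- The eight steps `(±1, ±1, ±1)` of the walk on the three dimensional diagonal lattice. -/
def steps : Finset (ℤ × ℤ × ℤ) :=
  ({-1, 1} : Finset ℤ) ×ˢ (({-1, 1} : Finset ℤ) ×ˢ ({-1, 1} : Finset ℤ))

/-- `S` is the symmetric random walk on the diagonal lattice, started in the origin: the increments
are independent and each of them takes each of the eight values `(±1, ±1, ±1)` with
probability `1 / 8`. -/
structure IsDiagonalWalk {Ω : Type*} [MeasurableSpace Ω] (P : Measure Ω)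
    (S : ℕ → Ω → ℤ × ℤ × ℤ) : Prop where
  measurable : ∀ n, Measurable (S n)
  start : ∀ᵐ ω ∂P, S 0 ω = 0
  indep : iIndepFun (fun n ω => S (n + 1) ω - S n ω) P
  law : ∀ n, ∀ e ∈ steps, P {ω | S (n + 1) ω - S n ω = e} = 1 / 8

/-- The expected number of visits to `x` (equivalently, of departures from `x`), the visit at time
`0` included. -/
noncomputable def expectedVisits {Ω : Type*} [MeasurableSpace Ω] (P : Measure Ω)
    (S : ℕ → Ω → ℤ × ℤ × ℤ) (x : ℤ × ℤ × ℤ) : ℝ≥0∞ :=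
  ∫⁻ ω, (({n : ℕ | S n ω = x}.encard : ℕ∞) : ℝ≥0∞) ∂P

/-- The difference equation for the expected number of visits, on the full lattice and with the
source in the origin. -/
def IsSolution (H : ℤ × ℤ × ℤ → ℝ) : Prop :=
  ∀ x, H x = (if x = 0 then 1 else 0) + (∑ e ∈ steps, H (x + e)) / 8

/-- `θ (s, t)` is a solution of `cos s * cos t * cosh θ = 1` with nonnegative real part, wherever a
solution exists, that is, off the null set `cos s * cos t = 0`.  Where `cos s * cos t` is negative,
`θ` is necessarily non-real.  Off a null set, `exp (-θ)` and `tanh θ` do not depend on the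
choice of `θ`. -/
def IsDispersion (θ : ℝ → ℝ → ℂ) : Prop :=
  ∀ s ∈ Set.Icc 0 Real.pi, ∀ t ∈ Set.Icc 0 Real.pi, Real.cos s * Real.cos t ≠ 0 →
    0 ≤ (θ s t).re ∧ (Real.cos s : ℂ) * (Real.cos t : ℂ) * Complex.cosh (θ s t) = 1

/-- The integrand `cos (u s) cos (v t) exp (-|w| θ) / tanh θ`. -/
noncomputable def integrand (θ : ℝ → ℝ → ℂ) (u v w : ℤ) (s t : ℝ) : ℂ :=
  (Real.cos (u * s) : ℂ) * (Real.cos (v * t) : ℂ) * Complex.exp (-((|w| : ℤ) : ℂ) * θ s t)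
    / Complex.tanh (θ s t)

end DiagonalLattice

namespace DiagonalLattice

/-! A uniform step in the eight vectors `(±1, ±1, ±1)` amounts to three independent signs, so the
law at time `n` is the product `diagLaw` of three simple-walk laws, and the expected number of
visits is `green`, the sum of `diagLaw` over `n`. Each factor is a Fourier coefficient of `cos ^ n`,
hence O(`n ^ (-1/2)`) by Wallis. The product is O(`n ^ (-3/2)`) uniformly in the point: this gives
finiteness, transience, decay at infinity and absolute convergence of the integral.

For the formula, only the first two factors are expanded as integrals (`fourierTerm`). Summing over
`n` under the integral leaves the generating function of the third factor at `z = cos s * cos t`,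
which `tsum_pow_mul_simpleLaw` evaluates in closed form through `θ`. Uniqueness is the maximum
principle, `harmonic_nonpos`. -/

/-- The law of the simple random walk on `ℤ`, started in the origin. -/
noncomputable def simpleLaw : ℕ → ℤ → ℝ
  | 0, k => if k = 0 then 1 else 0
  | n + 1, k => (simpleLaw n (k - 1) + simpleLaw n (k + 1)) / 2

/-! ### Fourier coefficients and decay of the simple-walk law -/

/-- The integral of `|cos| ^ n` over half a period. -/
noncomputable def absCosIntegral (n : ℕ) : ℝ := ∫ s in (0 : ℝ)..Real.pi, |Real.cos s| ^ n

theorem simpleLaw_nonneg (n : ℕ) (k : ℤ) : 0 ≤ simpleLaw n k := by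
  induction n generalizing k with
  | zero => unfold simpleLaw; split_ifs <;> norm_num
  | succ n ih => unfold simpleLaw; linarith [ih (k - 1), ih (k + 1)]

theorem simpleLaw_le_one (n : ℕ) (k : ℤ) : simpleLaw n k ≤ 1 := by
  induction n generalizing k with
  | zero => unfold simpleLaw; split_ifs <;> norm_num
  | succ n ih => unfold simpleLaw; linarith [ih (k - 1), ih (k + 1)]

theorem integral_cos_int_mul (k : ℤ) :
    ∫ s in (0 : ℝ)..Real.pi, Real.cos (k * s) = if k = 0 then Real.pi else 0 := by
  split_ifs with h
  · simp [h]
  · have hk : (k : ℝ) ≠ 0 := by exact_mod_cast h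
    rw [intervalIntegral.integral_comp_mul_left (fun s => Real.cos s) hk]
    simp [Real.sin_int_mul_pi]

/-- By the product-to-sum formula, an extra factor `cos s` averages the frequencies `k - 1` and `k +
1`, which is the recursion of `simpleLaw`. -/
theorem integral_cos_pow_mul_cos (n : ℕ) (k : ℤ) :
    ∫ s in (0 : ℝ)..Real.pi, Real.cos s ^ n * Real.cos (k * s) = Real.pi * simpleLaw n k := by
  induction n generalizing k with
  | zero => simp [simpleLaw, integral_cos_int_mul]
  | succ n ih =>
    have h : ∀ s : ℝ, Real.cos s ^ (n + 1) * Real.cos (k * s) =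
        (1 / 2) * (Real.cos s ^ n * Real.cos (((k - 1 : ℤ) : ℝ) * s) +
          Real.cos s ^ n * Real.cos (((k + 1 : ℤ) : ℝ) * s)) := by
      intro s
      have h1 : ((k - 1 : ℤ) : ℝ) * s = k * s - s := by push_cast; ring
      have h2 : ((k + 1 : ℤ) : ℝ) * s = k * s + s := by push_cast; ring
      rw [h1, h2, Real.cos_sub, Real.cos_add]
      ring
    simp_rw [h]
    rw [intervalIntegral.integral_const_mul, intervalIntegral.integral_add
      (Continuous.intervalIntegrable (by fun_prop) _ _)
      (Continuous.intervalIntegrable (by fun_prop) _ _), ih, ih]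
    simp only [simpleLaw]
    ring

theorem absCosIntegral_nonneg (n : ℕ) : 0 ≤ absCosIntegral n :=
  intervalIntegral.integral_nonneg Real.pi_pos.le fun _ _ => by positivity

theorem pi_mul_simpleLaw_le (n : ℕ) (k : ℤ) : Real.pi * simpleLaw n k ≤ absCosIntegral n := by
  rw [← integral_cos_pow_mul_cos]
  refine intervalIntegral.integral_mono_on Real.pi_pos.le
    (Continuous.intervalIntegrable (by fun_prop) _ _)
    (Continuous.intervalIntegrable (by fun_prop) _ _) fun s _ => ?_
  refine (le_abs_self _).trans ?_
  rw [abs_mul, abs_pow]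
  exact mul_le_of_le_one_right (by positivity) (Real.abs_cos_le_one _)

theorem absCosIntegral_eq_integral_sin_pow (n : ℕ) :
    absCosIntegral n = ∫ s in (0 : ℝ)..Real.pi, Real.sin s ^ n := by
  have hper : Function.Periodic (fun s : ℝ => |Real.sin s| ^ n) Real.pi := fun s => by
    simp [Real.sin_add_pi]
  have h1 : absCosIntegral n = ∫ s in (0 : ℝ)..Real.pi, |Real.sin (s + Real.pi / 2)| ^ n := by
    simp [absCosIntegral, Real.sin_add_pi_div_two]
  rw [h1, intervalIntegral.integral_comp_add_right (fun s => |Real.sin s| ^ n),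
    show Real.pi + Real.pi / 2 = (0 + Real.pi / 2) + Real.pi by ring,
    hper.intervalIntegral_add_eq _ 0, zero_add]
  refine intervalIntegral.integral_congr fun s hs => ?_
  rw [Set.uIcc_of_le Real.pi_pos.le] at hs
  simp only [abs_of_nonneg (Real.sin_nonneg_of_mem_Icc hs)]

/-- Wallis: the reduction formula for `sin ^ n` makes the left side independent of `n`. As the
integrals decrease in `n`, this yields their `n ^ (-1/2)` bound. -/
theorem absCosIntegral_succ_mul (n : ℕ) :
    (n + 1) * (absCosIntegral n * absCosIntegral (n + 1)) = 2 * Real.pi := by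
  simp only [absCosIntegral_eq_integral_sin_pow]
  induction n with
  | zero => simp [Real.cos_pi]; ring
  | succ n ih =>
    rw [integral_sin_pow n, ← ih]
    have : (n : ℝ) + 2 ≠ 0 := by positivity
    simp
    field_simp
    ring

theorem absCosIntegral_succ_le (n : ℕ) :
    absCosIntegral (n + 1) ≤ √(2 * Real.pi) / √((n + 1 : ℕ) : ℝ) := by
  rw [← Real.sqrt_div (by positivity)]
  apply Real.le_sqrt_of_sq_le
  rw [le_div_iff₀ (by positivity), ← absCosIntegral_succ_mul n, sq]
  have h : absCosIntegral (n + 1) ≤ absCosIntegral n := by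
    simp only [absCosIntegral_eq_integral_sin_pow]
    exact integral_sin_pow_succ_le n
  have := mul_le_mul_of_nonneg_right h (absCosIntegral_nonneg (n + 1))
  push_cast
  nlinarith [n.cast_nonneg (α := ℝ)]

theorem summable_absCosIntegral_pow_three : Summable fun n => absCosIntegral n ^ 3 := by
  rw [← summable_nat_add_iff 1]
  have hs : Summable fun n : ℕ => √(2 * Real.pi) ^ 3 * (1 / ((n + 1 : ℕ) : ℝ) ^ (3 / 2 : ℝ)) :=
    ((summable_nat_add_iff 1).2
      (Real.summable_one_div_nat_rpow.2 (by norm_num : (1 : ℝ) < 3 / 2))).mul_left _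
  refine Summable.of_nonneg_of_le (fun n => pow_nonneg (absCosIntegral_nonneg _) 3)
    (fun n => (pow_le_pow_left₀ (absCosIntegral_nonneg _) (absCosIntegral_succ_le n) 3).trans
      (le_of_eq ?_)) hs
  rw [div_pow, Real.sqrt_eq_rpow ((n + 1 : ℕ) : ℝ), ← Real.rpow_natCast (_ ^ (1 / 2 : ℝ)),
    ← Real.rpow_mul (by positivity), mul_one_div]
  norm_num

/-! ### Generating function of the simple walk -/

/-- The equation `g k = δ + z (g (k - 1) + g (k + 1)) / 2` has at most one bounded solution. -/
theorem eq_of_bounded_of_recursion {z : ℝ} (hz : |z| < 1) {g h b : ℤ → ℂ} {C D : ℝ}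
    (hg : ∀ k, g k = b k + z * ((g (k - 1) + g (k + 1)) / 2))
    (hh : ∀ k, h k = b k + z * ((h (k - 1) + h (k + 1)) / 2))
    (hgC : ∀ k, ‖g k‖ ≤ C) (hhD : ∀ k, ‖h k‖ ≤ D) (k : ℤ) : g k = h k := by
  -- The source `b` cancels in the difference, so each use of the recursion gains a factor `|z|`.
  have key : ∀ n : ℕ, ∀ k, ‖g k - h k‖ ≤ |z| ^ n * (C + D) := by
    intro n
    induction n with
    | zero => intro k; simpa using (norm_sub_le _ _).trans (add_le_add (hgC k) (hhD k))
    | succ n ih =>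
      intro k
      have e : g k - h k = z * (((g (k - 1) - h (k - 1)) + (g (k + 1) - h (k + 1))) / 2) := by
        rw [hg k, hh k]; ring
      rw [e, norm_mul, Complex.norm_real, Real.norm_eq_abs, pow_succ', mul_assoc]
      refine mul_le_mul_of_nonneg_left ?_ (abs_nonneg _)
      rw [norm_div, Complex.norm_two, div_le_iff₀ two_pos]
      exact (norm_add_le _ _).trans (by linarith [ih (k - 1), ih (k + 1)])
  have hlim : Tendsto (fun n : ℕ => |z| ^ n * (C + D)) atTop (𝓝 0) := by
    simpa using (tendsto_pow_atTop_nhds_zero_of_lt_one (abs_nonneg z) hz).mul_const (C + D)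
  have := ge_of_tendsto' hlim fun n => key n k
  exact sub_eq_zero.1 (norm_le_zero_iff.1 this)

theorem summable_pow_mul_simpleLaw {z : ℝ} (hz : |z| < 1) (k : ℤ) :
    Summable fun n => z ^ n * simpleLaw n k := by
  refine Summable.of_norm_bounded (summable_geometric_of_lt_one (abs_nonneg z) hz) fun n => ?_
  rw [norm_mul, norm_pow, Real.norm_eq_abs, Real.norm_eq_abs, abs_of_nonneg (simpleLaw_nonneg n k)]
  exact mul_le_of_le_one_right (by positivity) (simpleLaw_le_one n k)

/-- The generating function of the return probabilities of the simple random walk. -/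
theorem tsum_pow_mul_simpleLaw {z : ℝ} (hz : |z| < 1) {θ : ℂ} (hre : 0 ≤ θ.re)
    (hθ : z * Complex.cosh θ = 1) (k : ℤ) :
    ((∑' n, z ^ n * simpleLaw n k : ℝ) : ℂ) =
      Complex.exp (-((|k| : ℤ) : ℂ) * θ) / Complex.tanh θ := by
  have hcosh : Complex.cosh θ ≠ 0 := fun h => by simp [h] at hθ
  have hsinh : Complex.sinh θ ≠ 0 := by
    intro h
    have h1 := Complex.cosh_sq θ
    rw [h] at h1
    have h2 : (z : ℂ) ^ 2 = 1 := by
      have : ((z : ℂ) * Complex.cosh θ) ^ 2 = 1 := by rw [hθ]; norm_num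
      rw [mul_pow, h1] at this
      simpa using this
    have h3 : z ^ 2 = 1 := by exact_mod_cast h2
    have := (sq_lt_one_iff_abs_lt_one z).2 hz
    linarith
  have htanh : Complex.tanh θ ≠ 0 := by
    rw [Complex.tanh_eq_sinh_div_cosh]; exact div_ne_zero hsinh hcosh
  -- Both sides are bounded solutions of one recursion with a unit source at `0`; `0 ≤ θ.re` is what
  -- bounds the exponential.
  refine eq_of_bounded_of_recursion hz (b := fun k => if k = 0 then 1 else 0)
    (g := fun k => ((∑' n, z ^ n * simpleLaw n k : ℝ) : ℂ))
    (h := fun k => Complex.exp (-((|k| : ℤ) : ℂ) * θ) / Complex.tanh θ)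
    (C := (1 - |z|)⁻¹) (D := 1 / ‖Complex.tanh θ‖) ?_ ?_ ?_ ?_ k
  · intro k
    have h : (∑' n, z ^ n * simpleLaw n k) = (if k = 0 then 1 else 0) + z *
        (((∑' n, z ^ n * simpleLaw n (k - 1)) + ∑' n, z ^ n * simpleLaw n (k + 1)) / 2) := by
      rw [(summable_pow_mul_simpleLaw hz k).tsum_eq_zero_add,
        ← (summable_pow_mul_simpleLaw hz _).tsum_add (summable_pow_mul_simpleLaw hz _),
        ← tsum_div_const, ← tsum_mul_left]
      congr 1
      · simp [simpleLaw]
      · refine tsum_congr fun n => ?_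
        simp only [simpleLaw]
        ring
    rw [h]
    split_ifs <;> push_cast <;> rfl
  · intro k
    have hexp : ∀ j : ℤ, 0 ≤ j → Complex.exp (-((|j| : ℤ) : ℂ) * θ) = Complex.exp (-(j * θ)) := by
      intro j hj; rw [abs_of_nonneg hj]; ring_nf
    have hz2 : (z : ℂ) * ((Complex.exp θ + Complex.exp (-θ)) / 2) = 1 := by
      rw [← hθ, Complex.cosh]
    have main : ∀ k : ℤ, 0 < k → Complex.exp (-((|k| : ℤ) : ℂ) * θ) =
        z * ((Complex.exp (-((|k - 1| : ℤ) : ℂ) * θ) +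
          Complex.exp (-((|k + 1| : ℤ) : ℂ) * θ)) / 2) := by
      intro k hk
      rw [hexp k hk.le, hexp (k - 1) (by omega), hexp (k + 1) (by omega)]
      have h1 : -(((k - 1 : ℤ) : ℂ) * θ) = -(k * θ) + θ := by push_cast; ring
      have h2 : -(((k + 1 : ℤ) : ℂ) * θ) = -(k * θ) + -θ := by push_cast; ring
      rw [h1, h2, Complex.exp_add, Complex.exp_add]
      linear_combination -Complex.exp (-(k * θ)) * hz2
    have e3 : Complex.exp (-θ) = Complex.cosh θ - Complex.sinh θ := (Complex.cosh_sub_sinh θ).symm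
    rcases lt_trichotomy k 0 with hk | rfl | hk
    · have := main (-k) (by omega)
      rw [abs_neg, show -k - 1 = -(k + 1) by ring, show -k + 1 = -(k - 1) by ring, abs_neg,
        abs_neg] at this
      simp only [hk.ne, if_false]
      rw [this]
      ring
    -- At the source, with `exp (-θ) = cosh θ - sinh θ`, the claim is `coth θ = 1 + z * exp (-θ) *
    -- coth θ`, which follows from `z * cosh θ = 1`.
    · simp only [if_true]
      simp only [abs_zero, zero_sub, zero_add, abs_neg, abs_one, Int.cast_zero, Int.cast_one,
        neg_zero, zero_mul, Complex.exp_zero, neg_one_mul, e3]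
      rw [Complex.tanh_eq_sinh_div_cosh]
      field_simp
      linear_combination (-2 * Complex.cosh θ + 2 * Complex.sinh θ) * hθ
    · simp only [hk.ne', if_false]
      rw [main k hk]
      ring
  · intro k
    rw [Complex.norm_real]
    rw [← tsum_geometric_of_lt_one (abs_nonneg z) hz]
    refine tsum_of_norm_bounded (summable_geometric_of_lt_one (abs_nonneg z) hz).hasSum fun n => ?_
    rw [norm_mul, norm_pow, Real.norm_eq_abs, Real.norm_eq_abs,
      abs_of_nonneg (simpleLaw_nonneg n k)]
    exact mul_le_of_le_one_right (by positivity) (simpleLaw_le_one n k)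
  · intro k
    rw [norm_div]
    gcongr
    rw [Complex.norm_exp]
    apply Real.exp_le_one_iff.2
    have : (-((|k| : ℤ) : ℂ) * θ).re = -(((|k| : ℤ) : ℝ) * θ.re) := by
      rw [neg_mul, Complex.neg_re, ← Complex.ofReal_intCast, Complex.re_ofReal_mul]
    rw [this]
    have : (0 : ℝ) ≤ ((|k| : ℤ) : ℝ) := by exact_mod_cast abs_nonneg k
    nlinarith [mul_nonneg this hre]

/-! ### Green function of the diagonal walk -/

/-- The law of the walk on the diagonal lattice: its coordinates are independent simple walks. -/
noncomputable def diagLaw (n : ℕ) (x : ℤ × ℤ × ℤ) : ℝ :=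
  simpleLaw n x.1 * (simpleLaw n x.2.1 * simpleLaw n x.2.2)

theorem sum_steps (f : ℤ × ℤ × ℤ → ℝ) : ∑ e ∈ steps, f e =
    f (-1, -1, -1) + f (-1, -1, 1) + f (-1, 1, -1) + f (-1, 1, 1) +
      f (1, -1, -1) + f (1, -1, 1) + f (1, 1, -1) + f (1, 1, 1) := by
  have h : ∀ g : ℤ → ℝ, ∑ e ∈ ({-1, 1} : Finset ℤ), g e = g (-1) + g 1 := fun g =>
    Finset.sum_pair (by norm_num)
  simp only [steps, Finset.sum_product, h]
  ring

theorem diagLaw_zero (x : ℤ × ℤ × ℤ) : diagLaw 0 x = if x = 0 then 1 else 0 := by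
  obtain ⟨u, v, w⟩ := x
  simp only [diagLaw, simpleLaw, Prod.mk_eq_zero]
  split_ifs <;> simp_all

theorem diagLaw_succ (n : ℕ) (x : ℤ × ℤ × ℤ) :
    diagLaw (n + 1) x = (∑ e ∈ steps, diagLaw n (x + e)) / 8 := by
  obtain ⟨u, v, w⟩ := x
  rw [sum_steps]
  simp only [diagLaw, simpleLaw, Prod.mk_add_mk, ← sub_eq_add_neg]
  ring

theorem sum_steps_neg (f : ℤ × ℤ × ℤ → ℝ) : ∑ e ∈ steps, f (-e) = ∑ e ∈ steps, f e := by
  simp only [sum_steps, Prod.neg_mk, neg_neg]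
  ring

theorem diagLaw_nonneg (n : ℕ) (x : ℤ × ℤ × ℤ) : 0 ≤ diagLaw n x :=
  mul_nonneg (simpleLaw_nonneg _ _) (mul_nonneg (simpleLaw_nonneg _ _) (simpleLaw_nonneg _ _))

theorem diagLaw_le (n : ℕ) (x : ℤ × ℤ × ℤ) :
    diagLaw n x ≤ absCosIntegral n ^ 3 / Real.pi ^ 3 := by
  have h : ∀ k, simpleLaw n k ≤ absCosIntegral n / Real.pi := fun k => by
    rw [le_div_iff₀' Real.pi_pos]; exact pi_mul_simpleLaw_le n k
  have h0 := fun k => simpleLaw_nonneg n k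
  have hc : 0 ≤ absCosIntegral n / Real.pi := (h0 0).trans (h 0)
  calc diagLaw n x ≤ (absCosIntegral n / Real.pi) *
        ((absCosIntegral n / Real.pi) * (absCosIntegral n / Real.pi)) :=
        mul_le_mul (h _) (mul_le_mul (h _) (h _) (h0 _) hc) (mul_nonneg (h0 _) (h0 _)) hc
    _ = _ := by ring

theorem summable_diagLaw (x : ℤ × ℤ × ℤ) : Summable fun n => diagLaw n x :=
  Summable.of_nonneg_of_le (fun n => diagLaw_nonneg n x) (fun n => diagLaw_le n x)
    (summable_absCosIntegral_pow_three.div_const _)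

/-- The Green function of the walk on the diagonal lattice. -/
noncomputable def green (x : ℤ × ℤ × ℤ) : ℝ := ∑' n, diagLaw n x

theorem isSolution_green : IsSolution green := by
  intro x
  simp only [green]
  rw [(summable_diagLaw x).tsum_eq_zero_add, diagLaw_zero,
    ← Summable.tsum_finsetSum fun e _ => summable_diagLaw (x + e), ← tsum_div_const]
  simp only [diagLaw_succ]

theorem tendsto_diagLaw (n : ℕ) : Tendsto (diagLaw n) cofinite (𝓝 0) := by
  induction n with
  | zero =>
    refine tendsto_const_nhds.congr' ?_
    filter_upwards [(Set.finite_singleton (0 : ℤ × ℤ × ℤ)).compl_mem_cofinite] with x hx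
    rw [diagLaw_zero, if_neg (by simpa using hx)]
  | succ n ih =>
    have h := (tendsto_finsetSum steps fun e _ =>
      ih.comp (add_left_injective e).tendsto_cofinite).div_const 8
    simp only [Finset.sum_const_zero, zero_div] at h
    exact h.congr fun x => (diagLaw_succ n x).symm

/-- Each `diagLaw n` vanishes at infinity, and the bound of `diagLaw_le` is summable and uniform in
the point, so dominated convergence applies to the sum over `n`. -/
theorem tendsto_green : Tendsto green cofinite (𝓝 0) := by
  have h := tendsto_tsum_of_dominated_convergence (𝓕 := cofinite)
    (f := fun x n => diagLaw n x) (g := fun _ => (0 : ℝ))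
    (summable_absCosIntegral_pow_three.div_const (Real.pi ^ 3)) tendsto_diagLaw
    (Eventually.of_forall fun x n => by
      rw [Real.norm_eq_abs, abs_of_nonneg (diagLaw_nonneg n x)]; exact diagLaw_le n x)
  rw [tsum_zero] at h
  exact h

/-! ### Maximum principle and uniqueness -/

/-- A harmonic function that vanishes at infinity is nonpositive. -/
theorem harmonic_nonpos {d : ℤ × ℤ × ℤ → ℝ} (hd : ∀ x, d x = (∑ e ∈ steps, d (x + e)) / 8)
    (hlim : Tendsto d cofinite (𝓝 0)) (x : ℤ × ℤ × ℤ) : d x ≤ 0 := by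
  by_contra! hx
  have hfin : {y | d x ≤ d y}.Finite := by
    have := hlim.eventually_lt_const hx
    simpa [Filter.eventually_cofinite] using this
  obtain ⟨m, hm, hmax⟩ := hfin.exists_maximalFor d _ ⟨x, le_refl (d x)⟩
  have hle : ∀ y, d y ≤ d m := by
    intro y
    by_cases hy : d x ≤ d y
    · rcases le_total (d y) (d m) with h | h
      · exact h
      · exact hmax hy h
    · exact (not_le.1 hy).le.trans hm
  -- A maximum equal to the average of its neighbours is attained at all of them. Following one
  -- direction puts an infinite ray into the finite set of `hfin`.
  have hstep : ∀ n : ℕ, d (m + n • (1, 1, 1)) = d m := by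
    intro n
    induction n with
    | zero => simp
    | succ n ih =>
      have h := hd (m + n • (1, 1, 1))
      rw [ih, sum_steps] at h
      rw [succ_nsmul, ← add_assoc]
      linarith [hle (m + n • (1, 1, 1) + (-1, -1, -1)), hle (m + n • (1, 1, 1) + (-1, -1, 1)),
        hle (m + n • (1, 1, 1) + (-1, 1, -1)), hle (m + n • (1, 1, 1) + (-1, 1, 1)),
        hle (m + n • (1, 1, 1) + (1, -1, -1)), hle (m + n • (1, 1, 1) + (1, -1, 1)),
        hle (m + n • (1, 1, 1) + (1, 1, -1)), hle (m + n • (1, 1, 1) + (1, 1, 1))]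
  have hinj : Function.Injective fun n : ℕ => m + n • ((1, 1, 1) : ℤ × ℤ × ℤ) := by
    intro a b hab
    simpa using hab
  have hmem : ∀ n : ℕ, m + n • ((1, 1, 1) : ℤ × ℤ × ℤ) ∈ {y | d x ≤ d y} := fun n =>
    le_of_le_of_eq hm (hstep n).symm
  exact Set.infinite_of_injective_forall_mem hinj hmem hfin

theorem IsSolution.eq_of_tendsto {H K : ℤ × ℤ × ℤ → ℝ} (hH : IsSolution H) (hK : IsSolution K)
    (hH0 : Tendsto H cofinite (𝓝 0)) (hK0 : Tendsto K cofinite (𝓝 0)) : H = K := by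
  have key : ∀ {H K : ℤ × ℤ × ℤ → ℝ}, IsSolution H → IsSolution K → Tendsto H cofinite (𝓝 0) →
      Tendsto K cofinite (𝓝 0) → ∀ x, H x ≤ K x := by
    intro H K hH hK hH0 hK0 x
    refine sub_nonpos.1 (harmonic_nonpos (d := fun x => H x - K x) (fun y => ?_)
      (by simpa using hH0.sub hK0) x)
    rw [hH y, hK y, Finset.sum_sub_distrib]
    ring
  exact funext fun x => le_antisymm (key hH hK hH0 hK0 x) (key hK hH hK0 hH0 x)

/-! ### From the probability space to the Green function -/

theorem encard_visits {Ω : Type*} (S : ℕ → Ω → ℤ × ℤ × ℤ) (x : ℤ × ℤ × ℤ) (ω : Ω) :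
    (({n : ℕ | S n ω = x}.encard : ℕ∞) : ℝ≥0∞) = ∑' n, {ω | S n ω = x}.indicator 1 ω := by
  rw [← ENNReal.tsum_set_one, tsum_subtype {n : ℕ | S n ω = x} fun _ => (1 : ℝ≥0∞)]
  rfl

section Probability

variable {Ω : Type*} [MeasurableSpace Ω] {P : Measure Ω}
  {S : ℕ → Ω → ℤ × ℤ × ℤ}

theorem IsDiagonalWalk.measurable_increment (hS : IsDiagonalWalk P S) (n : ℕ) :
    Measurable fun ω => S (n + 1) ω - S n ω :=
  (hS.measurable (n + 1)).sub (hS.measurable n)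

theorem IsDiagonalWalk.ae_increment_mem [IsProbabilityMeasure P] (hS : IsDiagonalWalk P S) (n : ℕ) :
    ∀ᵐ ω ∂P, S (n + 1) ω - S n ω ∈ steps := by
  have hX := hS.measurable_increment n
  have hm : MeasurableSet {ω | S (n + 1) ω - S n ω ∈ steps} := hX steps.measurableSet
  refine (mem_ae_iff_prob_eq_one hm).2 ?_
  have h : {ω | S (n + 1) ω - S n ω ∈ steps} =
      ⋃ e ∈ steps, (fun ω => S (n + 1) ω - S n ω) ⁻¹' {e} := by
    ext ω; simp
  rw [h, measure_biUnion_finset (fun e _ f _ hef => Set.disjoint_left.2 fun ω h1 h2 =>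
    hef (h1.symm.trans h2)) (fun e _ => hX (MeasurableSet.singleton e))]
  refine (Finset.sum_congr rfl fun e he => hS.law n e he).trans ?_
  rw [Finset.sum_const, show steps.card = 8 from rfl, nsmul_eq_mul, one_div]
  exact ENNReal.mul_inv_cancel (by norm_num) (by norm_num)

theorem IsDiagonalWalk.indepFun_increment (hS : IsDiagonalWalk P S) (n : ℕ) :
    IndepFun (S n) (fun ω => S (n + 1) ω - S n ω) P := by
  have h := hS.indep.indepFun_sum_range_succ hS.measurable_increment n
  refine h.congr ?_ (ae_eq_refl _)
  filter_upwards [hS.start] with ω h0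
  rw [Finset.sum_apply, Finset.sum_range_sub (fun i => S i ω), h0, sub_zero]

theorem IsDiagonalWalk.measure_eq [IsProbabilityMeasure P] (hS : IsDiagonalWalk P S) (n : ℕ) (x : ℤ × ℤ × ℤ) :
    P {ω | S n ω = x} = ENNReal.ofReal (diagLaw n x) := by
  induction n generalizing x with
  | zero =>
    rw [diagLaw_zero]
    split_ifs with h
    · rw [ENNReal.ofReal_one, ← measure_univ (μ := P)]
      refine measure_congr ?_
      filter_upwards [hS.start] with ω h0
      exact propext ⟨fun _ => trivial, fun _ => h0.trans h.symm⟩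
    · rw [ENNReal.ofReal_zero]
      refine measure_mono_null (fun ω (hω : S 0 ω = x) => ?_) (ae_iff.1 hS.start)
      exact fun h0 => h (hω.symm.trans h0)
  | succ n ih =>
    -- Split by the last increment; the equality is only almost sure, since increments outside
    -- `steps` form a null event.
    have hae : {ω | S (n + 1) ω = x} =ᵐ[P]
        ⋃ e ∈ steps, (S n ⁻¹' {x + -e} ∩ (fun ω => S (n + 1) ω - S n ω) ⁻¹' {e} : Set Ω) := by
      filter_upwards [hS.ae_increment_mem n] with ω hω
      refine propext ?_
      constructor
      · intro h
        have h : S (n + 1) ω = x := h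
        refine Set.mem_biUnion hω ⟨?_, rfl⟩
        simp [← h]
      · intro h
        obtain ⟨e, -, h1, h2⟩ := Set.mem_iUnion₂.1 h
        have h1 : S n ω = x + -e := h1
        have h2 : S (n + 1) ω - S n ω = e := h2
        change S (n + 1) ω = x
        rw [← sub_add_cancel (S (n + 1) ω) (S n ω), h2, h1]
        abel
    rw [measure_congr hae, measure_biUnion_finset]
    · have hterm : ∀ e ∈ steps,
          P (S n ⁻¹' {x + -e} ∩ (fun ω => S (n + 1) ω - S n ω) ⁻¹' {e}) =
            ENNReal.ofReal (diagLaw n (x + -e) / 8) := by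
        intro e he
        rw [(hS.indepFun_increment n).measure_inter_preimage_eq_mul _ _
          (MeasurableSet.singleton _) (MeasurableSet.singleton _)]
        have h1 : P (S n ⁻¹' {x + -e}) = _ := ih (x + -e)
        have h2 : P ((fun ω => S (n + 1) ω - S n ω) ⁻¹' {e}) = _ := hS.law n e he
        rw [h1, h2, ENNReal.ofReal_div_of_pos (by norm_num), one_div, div_eq_mul_inv]
        norm_num
      rw [Finset.sum_congr rfl hterm, ← ENNReal.ofReal_sum_of_nonneg
        fun e _ => div_nonneg (diagLaw_nonneg _ _) (by norm_num), ← Finset.sum_div,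
        sum_steps_neg fun e => diagLaw n (x + e), diagLaw_succ]
    · intro e _ f _ hef
      refine Set.disjoint_left.2 fun ω h1 h2 => hef ?_
      exact h1.2.symm.trans h2.2
    · intro e _
      exact (hS.measurable n (MeasurableSet.singleton _)).inter
        (hS.measurable_increment n (MeasurableSet.singleton _))

theorem IsDiagonalWalk.expectedVisits_eq [IsProbabilityMeasure P] (hS : IsDiagonalWalk P S) (x : ℤ × ℤ × ℤ) :
    expectedVisits P S x = ENNReal.ofReal (green x) := by
  have hm : ∀ n, MeasurableSet {ω | S n ω = x} := fun n =>
    hS.measurable n (MeasurableSet.singleton x)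
  simp only [expectedVisits, encard_visits]
  rw [lintegral_tsum fun n => (measurable_one.indicator (hm n)).aemeasurable, green,
    ENNReal.ofReal_tsum_of_nonneg (fun n => diagLaw_nonneg n x) (summable_diagLaw x)]
  refine tsum_congr fun n => ?_
  rw [lintegral_indicator_one (hm n), hS.measure_eq]

theorem IsDiagonalWalk.measurable_encard_visits (hS : IsDiagonalWalk P S) (x : ℤ × ℤ × ℤ) :
    Measurable fun ω => (({n : ℕ | S n ω = x}.encard : ℕ∞) : ℝ≥0∞) := by
  have hm : ∀ n, MeasurableSet {ω | S n ω = x} := fun n =>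
    hS.measurable n (MeasurableSet.singleton x)
  simp only [encard_visits]
  exact Measurable.tsum fun n => measurable_one.indicator (hm n)

theorem IsDiagonalWalk.ae_finite_visits [IsProbabilityMeasure P] (hS : IsDiagonalWalk P S) (x : ℤ × ℤ × ℤ) :
    ∀ᵐ ω ∂P, {n : ℕ | S n ω = x}.Finite := by
  have hne : expectedVisits P S x ≠ ⊤ := by
    rw [hS.expectedVisits_eq]; exact ENNReal.ofReal_ne_top
  filter_upwards [ae_lt_top (hS.measurable_encard_visits x) hne] with ω hω
  rw [← Set.encard_lt_top_iff]
  simpa using hω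

end Probability

/-! ### The double integral -/

theorem integrable_tsum_of_summable_integral_norm {α : Type*} [MeasurableSpace α] {μ : Measure α}
    {F : ℕ → α → ℝ} (hF : ∀ n, Integrable (F n) μ) (hsum : Summable fun n => ∫ a, ‖F n a‖ ∂μ) :
    Integrable (fun a => ∑' n, F n a) μ := by
  refine ⟨(AEMeasurable.tsum fun n => (hF n).aemeasurable).aestronglyMeasurable, ?_⟩
  calc ∫⁻ a, ‖∑' n, F n a‖ₑ ∂μ ≤ ∫⁻ a, ∑' n, ‖F n a‖ₑ ∂μ :=
        lintegral_mono fun a => enorm_tsum_le_tsum_enorm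
    _ = ∑' n, ∫⁻ a, ‖F n a‖ₑ ∂μ := lintegral_tsum fun n => (hF n).aemeasurable.enorm
    _ = ∑' n, ENNReal.ofReal (∫ a, ‖F n a‖ ∂μ) :=
        tsum_congr fun n => (ofReal_integral_norm_eq_lintegral_enorm (hF n)).symm
    _ < ⊤ := hsum.tsum_ofReal_lt_top

/-- Lebesgue measure on `[0, π]`. -/
noncomputable def halfPeriod : Measure ℝ := volume.restrict (Set.Icc 0 Real.pi)

instance : IsFiniteMeasure halfPeriod :=
  inferInstanceAs (IsFiniteMeasure (volume.restrict (Set.Icc 0 Real.pi)))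

theorem integral_halfPeriod {E : Type*} [NormedAddCommGroup E] [NormedSpace ℝ E] (f : ℝ → E) :
    ∫ s, f s ∂halfPeriod = ∫ s in (0 : ℝ)..Real.pi, f s := by
  rw [halfPeriod, integral_Icc_eq_integral_Ioc, intervalIntegral.integral_of_le Real.pi_pos.le]

theorem integrable_halfPeriod {f : ℝ → ℝ} (hf : Continuous f) : Integrable f halfPeriod :=
  hf.continuousOn.integrableOn_Icc

theorem halfPeriod_prod : halfPeriod.prod halfPeriod =
    volume.restrict (Set.Icc 0 Real.pi ×ˢ Set.Icc 0 Real.pi) :=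
  Measure.prod_restrict _ _

/-- A nonzero cosine makes the equation for `θ` available; `|cos s| < 1` makes the power series in
`cos s * cos t` converge. -/
theorem ae_halfPeriod : ∀ᵐ s ∂halfPeriod,
    s ∈ Set.Icc 0 Real.pi ∧ Real.cos s ≠ 0 ∧ |Real.cos s| < 1 := by
  have h1 : ∀ᵐ s ∂halfPeriod, s ∈ Set.Icc 0 Real.pi := ae_restrict_mem measurableSet_Icc
  have h2 : ∀ᵐ s ∂halfPeriod, s ∉ ({0, Real.pi / 2, Real.pi} : Set ℝ) :=
    ae_restrict_of_ae
      ((Set.toFinite ({0, Real.pi / 2, Real.pi} : Set ℝ)).countable.ae_notMem volume)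
  filter_upwards [h1, h2] with s hs hs'
  simp only [Set.mem_insert_iff, Set.mem_singleton_iff, not_or] at hs'
  obtain ⟨h0, hm, hp⟩ := hs'
  have hinj := Real.injOn_cos
  refine ⟨hs, fun h => hm (hinj hs ⟨by positivity, by linarith [Real.pi_pos]⟩ (by simp [h])), ?_⟩
  refine lt_of_le_of_ne (Real.abs_cos_le_one s) fun h => ?_
  rcases (abs_eq zero_le_one).1 h with h | h
  · exact h0 (hinj hs ⟨le_rfl, Real.pi_pos.le⟩ (by simp [h]))
  · exact hp (hinj hs ⟨Real.pi_pos.le, le_rfl⟩ (by simp [h]))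

/-- The Fourier integrand of `diagLaw n (u, v, w)`, with the last coordinate summed out. -/
noncomputable def fourierTerm (u v w : ℤ) (n : ℕ) (p : ℝ × ℝ) : ℝ :=
  (Real.cos p.1 ^ n * Real.cos (u * p.1) * simpleLaw n w) *
    (Real.cos p.2 ^ n * Real.cos (v * p.2))

theorem integrable_fourierTerm (u v w : ℤ) (n : ℕ) :
    Integrable (fourierTerm u v w n) (halfPeriod.prod halfPeriod) :=
  (integrable_halfPeriod (f := fun s => Real.cos s ^ n * Real.cos (u * s) * simpleLaw n w)
    (by fun_prop)).mul_prod
    (integrable_halfPeriod (f := fun t => Real.cos t ^ n * Real.cos (v * t)) (by fun_prop))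

theorem integral_fourierTerm (u v w : ℤ) (n : ℕ) :
    ∫ p, fourierTerm u v w n p ∂(halfPeriod.prod halfPeriod) =
      Real.pi ^ 2 * diagLaw n (u, v, w) := by
  simp only [fourierTerm]
  rw [integral_prod_mul (fun s => Real.cos s ^ n * Real.cos (u * s) * simpleLaw n w)
    fun t => Real.cos t ^ n * Real.cos (v * t), integral_mul_const, integral_halfPeriod,
    integral_halfPeriod, integral_cos_pow_mul_cos, integral_cos_pow_mul_cos, diagLaw]
  ring

/-- The two integrations supply two factors `absCosIntegral n`; the third comes from the bound on
`simpleLaw n w`, and all three are needed for summability. -/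
theorem integral_norm_fourierTerm_le (u v w : ℤ) (n : ℕ) :
    ∫ p, ‖fourierTerm u v w n p‖ ∂(halfPeriod.prod halfPeriod) ≤
      absCosIntegral n ^ 3 / Real.pi := by
  have hlaw : simpleLaw n w ≤ absCosIntegral n / Real.pi := by
    rw [le_div_iff₀' Real.pi_pos]; exact pi_mul_simpleLaw_le n w
  calc ∫ p, ‖fourierTerm u v w n p‖ ∂(halfPeriod.prod halfPeriod)
      ≤ ∫ p : ℝ × ℝ, (|Real.cos p.1| ^ n * (absCosIntegral n / Real.pi)) *
          |Real.cos p.2| ^ n ∂(halfPeriod.prod halfPeriod) := by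
        refine integral_mono (integrable_fourierTerm u v w n).norm
          ((integrable_halfPeriod (f := fun s => |Real.cos s| ^ n * (absCosIntegral n / Real.pi))
            (by fun_prop)).mul_prod
          (integrable_halfPeriod (f := fun s => |Real.cos s| ^ n) (by fun_prop))) fun p => ?_
        simp only [fourierTerm, Real.norm_eq_abs, abs_mul, abs_pow,
          abs_of_nonneg (simpleLaw_nonneg n w)]
        have h0 := simpleLaw_nonneg n w
        have hA : 0 ≤ absCosIntegral n / Real.pi := h0.trans hlaw
        refine mul_le_mul (mul_le_mul ?_ hlaw h0 (by positivity)) ?_ (by positivity)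
          (by positivity)
        · exact mul_le_of_le_one_right (by positivity) (Real.abs_cos_le_one _)
        · exact mul_le_of_le_one_right (by positivity) (Real.abs_cos_le_one _)
    _ = absCosIntegral n ^ 3 / Real.pi := by
        rw [integral_prod_mul (fun s => |Real.cos s| ^ n * (absCosIntegral n / Real.pi))
          fun t => |Real.cos t| ^ n, integral_mul_const, integral_halfPeriod, absCosIntegral]
        ring

theorem summable_integral_norm_fourierTerm (u v w : ℤ) :
    Summable fun n => ∫ p, ‖fourierTerm u v w n p‖ ∂(halfPeriod.prod halfPeriod) :=
  Summable.of_nonneg_of_le (fun _ => integral_nonneg fun _ => norm_nonneg _)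
    (integral_norm_fourierTerm_le u v w) (summable_absCosIntegral_pow_three.div_const _)

theorem integral_tsum_fourierTerm (u v w : ℤ) :
    ∫ p, ∑' n, fourierTerm u v w n p ∂(halfPeriod.prod halfPeriod) =
      Real.pi ^ 2 * green (u, v, w) := by
  rw [← integral_tsum_of_summable_integral_norm (integrable_fourierTerm u v w)
    (summable_integral_norm_fourierTerm u v w)]
  simp only [integral_fourierTerm, tsum_mul_left, green]

theorem IsDispersion.integrand_ae_eq {θ : ℝ → ℝ → ℂ} (hθ : IsDispersion θ) (u v w : ℤ) :
    (fun p : ℝ × ℝ => integrand θ u v w p.1 p.2) =ᵐ[halfPeriod.prod halfPeriod]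
      fun p => ((∑' n, fourierTerm u v w n p : ℝ) : ℂ) := by
  have h1 := Measure.quasiMeasurePreserving_fst (μ := halfPeriod) (ν := halfPeriod)
    |>.ae ae_halfPeriod
  have h2 := Measure.quasiMeasurePreserving_snd (μ := halfPeriod) (ν := halfPeriod)
    |>.ae ae_halfPeriod
  filter_upwards [h1, h2] with p ⟨hs, hs0, hs1⟩ ⟨ht, ht0, ht1⟩
  obtain ⟨hre, hcosh⟩ := hθ p.1 hs p.2 ht (mul_ne_zero hs0 ht0)
  have hz : |Real.cos p.1 * Real.cos p.2| < 1 := by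
    rw [abs_mul]; exact mul_lt_one_of_nonneg_of_lt_one_left (abs_nonneg _) hs1 ht1.le
  have hsum := tsum_pow_mul_simpleLaw hz hre (by push_cast at hcosh ⊢; exact hcosh) w
  have hterm : ∑' n, fourierTerm u v w n p = Real.cos (u * p.1) * Real.cos (v * p.2) *
      ∑' n, (Real.cos p.1 * Real.cos p.2) ^ n * simpleLaw n w := by
    rw [← tsum_mul_left]
    refine tsum_congr fun n => ?_
    rw [fourierTerm]
    ring
  rw [hterm, Complex.ofReal_mul, hsum, integrand, Complex.ofReal_mul]
  ring

theorem IsDispersion.integrableOn {θ : ℝ → ℝ → ℂ} (hθ : IsDispersion θ) (u v w : ℤ) :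
    IntegrableOn (fun p : ℝ × ℝ => integrand θ u v w p.1 p.2)
      (Set.Icc 0 Real.pi ×ˢ Set.Icc 0 Real.pi) := by
  rw [IntegrableOn, ← halfPeriod_prod]
  exact (integrable_tsum_of_summable_integral_norm (integrable_fourierTerm u v w)
    (summable_integral_norm_fourierTerm u v w)).ofReal.congr (hθ.integrand_ae_eq u v w).symm

theorem IsDispersion.integral_integrand {θ : ℝ → ℝ → ℂ} (hθ : IsDispersion θ) (u v w : ℤ) :
    ∫ t in (0 : ℝ)..Real.pi, ∫ s in (0 : ℝ)..Real.pi, integrand θ u v w s t =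
      (Real.pi : ℂ) ^ 2 * green (u, v, w) := by
  have hint := hθ.integrableOn u v w
  rw [IntegrableOn, ← halfPeriod_prod] at hint
  simp only [← integral_halfPeriod]
  rw [← integral_prod_symm _ hint, integral_congr_ae (hθ.integrand_ae_eq u v w),
    integral_complex_ofReal, integral_tsum_fourierTerm]
  push_cast
  rfl

theorem exists_isDispersion : ∃ θ, IsDispersion θ := by
  have h : ∀ c : ℂ, c ≠ 0 → ∃ z : ℂ, 0 ≤ z.re ∧ c * Complex.cosh z = 1 := by
    intro c hc
    obtain ⟨y, hy⟩ := Complex.cos_surjective c⁻¹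
    have hcosh : Complex.cosh (y * Complex.I) = c⁻¹ := by rw [Complex.cosh_mul_I, hy]
    -- `cosh` is even, so the sign of the root can be chosen to make the real part nonnegative.
    rcases le_total 0 (y * Complex.I).re with h | h
    · exact ⟨y * Complex.I, h, by rw [hcosh, mul_inv_cancel₀ hc]⟩
    · exact ⟨-(y * Complex.I), by rw [Complex.neg_re]; linarith,
        by rw [Complex.cosh_neg, hcosh, mul_inv_cancel₀ hc]⟩
  choose! f hf using h
  refine ⟨fun s t => f (Real.cos s * Real.cos t), fun s _ t _ hst => hf _ ?_⟩
  exact_mod_cast hst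

end DiagonalLattice

theorem mainTheorem6 {Ω : Type*} [MeasurableSpace Ω] (P : Measure Ω) [IsProbabilityMeasure P]
    (S : ℕ → Ω → ℤ × ℤ × ℤ) (hS : DiagonalLattice.IsDiagonalWalk P S) :
    -- the walk is transient, and the expected numbers of visits are finite
    (∀ x, ∀ᵐ ω ∂P, {n : ℕ | S n ω = x}.Finite) ∧
    (∀ x, DiagonalLattice.expectedVisits P S x ≠ ⊤) ∧
    -- the integral formula, for every admissible choice of `θ`
    (∃ θ, DiagonalLattice.IsDispersion θ) ∧
    (∀ θ, DiagonalLattice.IsDispersion θ → ∀ u v w : ℤ,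
      IntegrableOn (fun p : ℝ × ℝ => DiagonalLattice.integrand θ u v w p.1 p.2)
        (Set.Icc 0 Real.pi ×ˢ Set.Icc 0 Real.pi) ∧
      ((DiagonalLattice.expectedVisits P S (u, v, w)).toReal : ℂ) =
        1 / (Real.pi : ℂ) ^ 2 *
          ∫ t in (0 : ℝ)..Real.pi, ∫ s in (0 : ℝ)..Real.pi,
            DiagonalLattice.integrand θ u v w s t) ∧
    -- it is the unique solution of the difference equation that vanishes at infinity
    DiagonalLattice.IsSolution (fun x => (DiagonalLattice.expectedVisits P S x).toReal) ∧
    Tendsto (fun x => (DiagonalLattice.expectedVisits P S x).toReal) cofinite (𝓝 0) ∧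
    (∀ H : ℤ × ℤ × ℤ → ℝ, DiagonalLattice.IsSolution H → Tendsto H cofinite (𝓝 0) →
      ∀ x, H x = (DiagonalLattice.expectedVisits P S x).toReal) := by
  have hgreen : ∀ x, (DiagonalLattice.expectedVisits P S x).toReal = DiagonalLattice.green x :=
    fun x => by
      rw [hS.expectedVisits_eq]
      exact ENNReal.toReal_ofReal (tsum_nonneg fun n => DiagonalLattice.diagLaw_nonneg n x)
  simp only [hgreen]
  refine ⟨hS.ae_finite_visits, fun x => ?_, DiagonalLattice.exists_isDispersion,
    fun θ hθ u v w => ⟨hθ.integrableOn u v w, ?_⟩, DiagonalLattice.isSolution_green,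
    DiagonalLattice.tendsto_green, fun H hH hH0 x => ?_⟩
  · rw [hS.expectedVisits_eq]
    exact ENNReal.ofReal_ne_top
  · have hpi : (Real.pi : ℂ) ≠ 0 := by exact_mod_cast Real.pi_ne_zero
    rw [hθ.integral_integrand]
    field_simp
  · exact congrFun (hH.eq_of_tendsto DiagonalLattice.isSolution_green hH0
      DiagonalLattice.tendsto_green) x
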